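/- **Model.** An $n$-vertex graph $G$ represents a synchronous message-passing network. Each vertex hosts a processor (a random access machine with unit-cost addition, subtraction, indirect addressing and fair coin flips), all vertices run the same program, and the coin flips of all vertices are independent. Initially a vertex knows only $n$, its degree, and its identity number; the identity numbers are distinct and form the set $\{1,\dots,n\}$. The neighbors of a vertex are accessible through ports, numbered arbitrarily. In every round each vertex sends one message to each neighbor, which arrives by the beginning of the next round; before the first round and after every round each vertex performs a local computation. The running time is the number of rounds until all vertices terminate with an output. The girth of a forest is $\infty$. **Theorem.** For every constant $c\in\mathbb N$ there is a constant $C$ such that for every real $\varepsilon>0$ there are a number $n_0$ and a polynomial $p$ (depending only on $c$ and $\varepsilon$) such that for every integer $k\ge 2$ there is a randomized distributed algorithm that terminates within at most $C/\varepsilon^2$ rounds and has the following properties on every $n$-vertex graph $G$ of girth greater than $2k$ with $n\ge n_0$, for every assignment of the identity numbers and of the port numbers: 1. every local computation of every vertex takes at most $p(n)$ steps, for every outcome of the coin flips; 2. every message consists of at most $C\lfloor\log_2 n\rfloor$ bits, for every outcome of the coin flips; 3. with probability at least $1-n^{-c}$, the outputs of the vertices form a proper coloring of $G$ with colors from $\{1,\dots,\lfloor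 n^{1/k+\varepsilon}\rfloor\}$. -/

import Mathlib

open scoped ENNReal

namespace Distributed

/-- Programs of the processor that a vertex hosts: a random access machine with a memory of cells
`M[0], M[1], …` holding natural numbers, with addition and truncated subtraction as its arithmetic,
with indirect addressing and structured control flow, a fair coin, and numbered ports to the
neighbours.
* `const d a`: `M[d] := a`
* `add d a b`: `M[d] := M[a] + M[b]`
* `sub d a b`: `M[d] := M[a] - M[b]` (`0` if negative)
* `load d a`: `M[d] := M[M[a]]`
* `store a b`: `M[M[a]] := M[b]`
* `flip d`: `M[d] :=` a fresh random bit
* `recv d a`: `M[d] :=` the message that has arrived through port number `M[a]`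
* `send a b`: put `M[b]` into port number `M[a]` as the message to be sent
* `skip`, `seq p q`: do nothing; first `p`, then `q`
* `ite a p q`: if `M[a] ≠ 0` then `p` else `q`
* `loop a p`: while `M[a] ≠ 0` do `p` -/
inductive Prog : Type
  | const (d a : ℕ)
  | add (d a b : ℕ)
  | sub (d a b : ℕ)
  | load (d a : ℕ)
  | store (a b : ℕ)
  | flip (d : ℕ)
  | recv (d a : ℕ)
  | send (a b : ℕ)
  | skip
  | seq (p q : Prog)
  | ite (a : ℕ) (p q : Prog)
  | loop (a : ℕ) (p : Prog)

/-- The data of one processor: its memory, the messages that have arrived (by port number), the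
messages that are to be sent (by port number; `0` is the empty message), and the random bits that
are still unused. -/
structure Local : Type where
  mem : ℕ → ℕ
  inbox : ℕ → ℕ
  outbox : ℕ → ℕ
  coins : ℕ → Bool

/-- `M[d] := x`. -/
def Local.write (s : Local) (d x : ℕ) : Local :=
  { s with mem := Function.update s.mem d x }

/-- One step of a processor. A configuration consists of the list of programs that remain to be
executed, one after the other, and of the data; the processor has halted when the list is empty. -/
def step : List Prog × Local → List Prog × Local
  | ([], s) => ([], s)
  | (.const d a :: K, s) => (K, s.write d a)
  | (.add d a b :: K, s) => (K, s.write d (s.mem a + s.mem b))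
  | (.sub d a b :: K, s) => (K, s.write d (s.mem a - s.mem b))
  | (.load d a :: K, s) => (K, s.write d (s.mem (s.mem a)))
  | (.store a b :: K, s) => (K, s.write (s.mem a) (s.mem b))
  | (.flip d :: K, s) =>
      (K, { s.write d (s.coins 0).toNat with coins := fun j => s.coins (j + 1) })
  | (.recv d a :: K, s) => (K, s.write d (s.inbox (s.mem a)))
  | (.send a b :: K, s) =>
      (K, { s with outbox := Function.update s.outbox (s.mem a) (s.mem b) })
  | (.skip :: K, s) => (K, s)
  | (.seq p q :: K, s) => (p :: q :: K, s)
  | (.ite a p q :: K, s) => (if s.mem a ≠ 0 then p :: K else q :: K, s)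
  | (.loop a p :: K, s) => (if s.mem a ≠ 0 then p :: .loop a p :: K else K, s)

/-- The configuration reached after `B` steps of the program `P` started on the data `s`. -/
def runFor (P : Prog) (B : ℕ) (s : Local) : List Prog × Local :=
  step^[B] ([P], s)

/-- A port numbering: the vertex `v` has the ports `0, …, deg v - 1`, one for each neighbour. -/
abbrev PortNumbering {n : ℕ} (G : SimpleGraph (Fin n)) : Type :=
  ∀ v : Fin n, Fin (Nat.card (G.neighborSet v)) ≃ G.neighborSet v

/-- The random bits of all vertices: `ω (v, r, j)` is the `j`-th bit for `v` after round `r`. -/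
abbrev Coins (n : ℕ) : Type := Fin n × ℕ × ℕ → Bool

/-- All random bits are independent and fair. -/
noncomputable def coinMeasure (n : ℕ) : MeasureTheory.Measure (Coins n) :=
  MeasureTheory.Measure.infinitePi fun _ => (PMF.uniformOfFintype Bool).toMeasure

section Execution

variable {n : ℕ} {G : SimpleGraph (Fin n)}

/-- The message that arrives at `v` through port `i`, if `out u j` is the message that `u` sends
through port `j`. -/
noncomputable def deliver (port : PortNumbering G) (out : Fin n → ℕ → ℕ) (v : Fin n) (i : ℕ) : ℕ :=
  if h : i < Nat.card (G.neighborSet v) then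
    out (port v ⟨i, h⟩) ((port (port v ⟨i, h⟩)).symm ⟨v, (port v ⟨i, h⟩).2.symm⟩)
  else 0

/-- The initial memory of `v`: the number `n` of vertices, the identity number of `v` in
`{1, …, n}`, and the degree of `v`. -/
noncomputable def initialMem (G : SimpleGraph (Fin n)) (v : Fin n) : ℕ → ℕ
  | 0 => n
  | 1 => v + 1
  | 2 => Nat.card (G.neighborSet v)
  | _ => 0

/-- `config P B port ω r v` is the configuration of the vertex `v` at the end of its local
computation after `r` communication rounds, when every local computation consists of `B` steps of
`P`. The local computation before the first round starts on the initial memory; in every round the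
messages in the outboxes are delivered, and then the next local computation starts with the memory
that the previous one has left, with an empty outbox and with fresh random bits. -/
noncomputable def config (P : Prog) (B : ℕ) (port : PortNumbering G) (ω : Coins n) :
    ℕ → Fin n → List Prog × Local
  | 0, v => runFor P B
      { mem := initialMem G v
        inbox := fun _ => 0
        outbox := fun _ => 0
        coins := fun j => ω (v, 0, j) }
  | r + 1, v => runFor P B
      { mem := (config P B port ω r v).2.mem
        inbox := deliver port (fun u => (config P B port ω r u).2.outbox) v
        outbox := fun _ => 0
        coins := fun j => ω (v, r + 1, j) }

/-- Every local computation in the first `T` rounds halts within `B` steps. -/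
def LocalTimeAtMost (P : Prog) (T B : ℕ) (port : PortNumbering G) : Prop :=
  ∀ (ω : Coins n) (r : ℕ), r ≤ T → ∀ v : Fin n, (config P B port ω r v).1 = []

/-- Every message that is sent in the first `T` rounds has at most `L` bits. -/
def MessagesAtMost (P : Prog) (T B L : ℕ) (port : PortNumbering G) : Prop :=
  ∀ (ω : Coins n) (r : ℕ), r < T → ∀ (v : Fin n) (i : ℕ), i < Nat.card (G.neighborSet v) →
    Nat.size ((config P B port ω r v).2.outbox i) ≤ L

/-- The output of `v` after `T` rounds, found in the memory cell `M[3]`. -/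
noncomputable def output (P : Prog) (T B : ℕ) (port : PortNumbering G) (ω : Coins n)
    (v : Fin n) : ℕ :=
  (config P B port ω T v).2.mem 3

/-- `col` is a proper coloring of `G` with colors from `{1, …, ⌊q⌋}`. -/
def IsProperColoring (G : SimpleGraph (Fin n)) (q : ℝ) (col : Fin n → ℕ) : Prop :=
  (∀ v, 1 ≤ col v ∧ (col v : ℝ) ≤ q) ∧ ∀ u v, G.Adj u v → col u ≠ col v

end Execution

end Distributed

/-! Let `D = ⌈3 / ε⌉` and `K = min k D`, and let `A` be a power of two with `n ≤ A ^ K` and `A ≤ 2 n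
^ (1 / K)`. Repeatedly delete all vertices with at most `A` remaining neighbours. A vertex surviving
`K` rounds would be the root of a tree of depth `K` in which every inner vertex has at least `A`
children; girth above `2 K` makes the `A ^ K ≥ n` leaves distinct, and none of them is the root,
which is too many vertices (`alive_eq_empty`). The deletion round of a vertex is its level, and each
vertex has at most `A` neighbours on its own level (`card_level_eq_le`).

A colour is the level followed by `t` random bits, where `2 ^ t ≥ A n ^ (1 / D)`. Vertices on
different levels never clash. A vertex that clashes with a neighbour redraws its bits. A clash after
a redrawing round needs an end that clashed before and whose fresh bits hit one given string, so
each such round multiplies the bound on the clash probability by `2 A / 2 ^ t ≤ 2 n ^ (-1 / D)`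
(`measure_hit_le`, `measure_conflict_succ_le`). After `D (c + 2)` rounds it is at most `2 ^ (D (c +
2)) / n ^ (c + 2) ≤ n ^ (-(c + 1))`, and a union bound over the vertices finishes.

The colours number at most a constant times `2 ^ t`, hence at most `n ^ (1 / K + 2 / D)` for large
`n`, and `1 / K + 2 / D ≤ 1 / k + 3 / D ≤ 1 / k + ε`. The rest verifies that a concrete machine
program carries out this process (`config_colorProg`). -/

namespace Distributed

/-! ### A program logic with step counts -/

/-- `P`, started on `s`, ends within `N` steps on data that satisfy `Q`. -/
def Ends (P : Prog) (N : ℕ) (Q : Local → Prop) (s : Local) : Prop :=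
  ∃ s', (∃ m ≤ N, ∀ K, step^[m] (P :: K, s) = (K, s')) ∧ Q s'

theorem Ends.mono {P : Prog} {N N' : ℕ} {Q Q' : Local → Prop} {s : Local} (h : Ends P N Q s)
    (hN : N ≤ N') (hQ : ∀ s, Q s → Q' s) : Ends P N' Q' s := by
  obtain ⟨s', ⟨m, hm, h⟩, hs⟩ := h
  exact ⟨s', ⟨m, hm.trans hN, h⟩, hQ _ hs⟩

theorem ends_of_step {P : Prog} {Q : Local → Prop} {s s' : Local}
    (h : ∀ K, step (P :: K, s) = (K, s')) (hQ : Q s') : Ends P 1 Q s :=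
  ⟨s', ⟨1, le_rfl, h⟩, hQ⟩

section

variable {Q : Local → Prop} {s : Local} {d a b : ℕ}

/-- The rules are in weakest-precondition form, so that chaining them computes the final data
backwards from the postcondition. -/
theorem ends_const (h : Q (s.write d a)) : Ends (.const d a) 1 Q s :=
  ends_of_step (fun _ => rfl) h

theorem ends_add (h : Q (s.write d (s.mem a + s.mem b))) : Ends (.add d a b) 1 Q s :=
  ends_of_step (fun _ => rfl) h

theorem ends_sub (h : Q (s.write d (s.mem a - s.mem b))) : Ends (.sub d a b) 1 Q s :=
  ends_of_step (fun _ => rfl) h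

theorem ends_flip
    (h : Q { s.write d (s.coins 0).toNat with coins := fun j => s.coins (j + 1) }) :
    Ends (.flip d) 1 Q s :=
  ends_of_step (fun _ => rfl) h

theorem ends_recv (h : Q (s.write d (s.inbox (s.mem a)))) : Ends (.recv d a) 1 Q s :=
  ends_of_step (fun _ => rfl) h

theorem ends_send
    (h : Q { s with outbox := Function.update s.outbox (s.mem a) (s.mem b) }) :
    Ends (.send a b) 1 Q s :=
  ends_of_step (fun _ => rfl) h

theorem ends_skip (h : Q s) : Ends .skip 1 Q s :=
  ends_of_step (fun _ => rfl) h

theorem ends_seq {p q : Prog} {M N : ℕ} (h : Ends p M (Ends q N Q) s) :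
    Ends (.seq p q) (M + N + 1) Q s := by
  obtain ⟨s', ⟨m, hm, h⟩, s'', ⟨m', hm', h'⟩, hQ⟩ := h
  refine ⟨s'', ⟨m' + m + 1, by omega, fun K => ?_⟩, hQ⟩
  rw [Function.iterate_succ_apply, Function.iterate_add_apply]
  change step^[m'] (step^[m] (p :: q :: K, s)) = _
  rw [h, h']

theorem ends_ite {p q : Prog} {N : ℕ} (hp : s.mem a ≠ 0 → Ends p N Q s)
    (hq : s.mem a = 0 → Ends q N Q s) : Ends (.ite a p q) (N + 1) Q s := by
  by_cases ha : s.mem a = 0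
  · obtain ⟨s', ⟨m, hm, h⟩, hQ⟩ := hq ha
    refine ⟨s', ⟨m + 1, by omega, fun K => ?_⟩, hQ⟩
    rw [Function.iterate_succ_apply, ← h]
    simp [step, ha]
  · obtain ⟨s', ⟨m, hm, h⟩, hQ⟩ := hp ha
    refine ⟨s', ⟨m + 1, by omega, fun K => ?_⟩, hQ⟩
    rw [Function.iterate_succ_apply, ← h]
    simp [step, ha]

/-- A loop whose body leads from the invariant `I i` to the invariant `I (i + 1)`. -/
theorem ends_loop {p : Prog} {N m : ℕ} (I : ℕ → Local → Prop)
    (hI : ∀ i < m, ∀ s, I i s → s.mem a ≠ 0 ∧ Ends p N (I (i + 1)) s)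
    (hm : ∀ s, I m s → s.mem a = 0) (h₀ : I 0 s) (hQ : ∀ s, I m s → Q s) :
    Ends (.loop a p) (m * (N + 1) + 1) Q s := by
  suffices H : ∀ j i s, i + j = m → I i s → Ends (.loop a p) (j * (N + 1) + 1) (I m) s from
    (H m 0 s (zero_add m) h₀).mono le_rfl hQ
  intro j
  induction j with
  | zero =>
    rintro i s rfl hs
    refine Ends.mono (ends_of_step (s' := s) (fun K => ?_) hs) (by omega) fun _ h => h
    simp [step, hm s hs]
  | succ j ih =>
    intro i s hij hs
    obtain ⟨ha, s', ⟨l, hl, h⟩, hs'⟩ := hI i (by omega) s hs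
    obtain ⟨s'', ⟨l', hl', h'⟩, hs''⟩ := ih (i + 1) s' (by omega) hs'
    refine ⟨s'', ⟨l' + l + 1, by rw [Nat.succ_mul]; omega, fun K => ?_⟩, hs''⟩
    rw [Function.iterate_succ_apply, Function.iterate_add_apply]
    have : step (Prog.loop a p :: K, s) = (p :: .loop a p :: K, s) := by simp [step, ha]
    rw [this, h, h']

end

/-- A halted configuration is fixed by `step`, so a step budget larger than needed is harmless. -/
theorem runFor_of_ends {P : Prog} {N B : ℕ} {Q : Local → Prop} {s : Local} (h : Ends P N Q s)
    (hB : N ≤ B) : (runFor P B s).1 = [] ∧ Q (runFor P B s).2 := by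
  obtain ⟨s', ⟨m, hm, h⟩, hQ⟩ := h
  have h' : ∀ j, step^[j] ([], s') = ([], s') := fun j =>
    Function.iterate_fixed (by rfl) j
  have : runFor P B s = ([], s') := by
    obtain ⟨j, rfl⟩ := Nat.exists_eq_add_of_le (hm.trans hB)
    rw [runFor, add_comm, Function.iterate_add_apply, h, h']
  rw [this]
  exact ⟨rfl, hQ⟩

/-! ### The program of a vertex and its verification -/

/-- `M[a] := 2 ^ k * M[a]`. -/
def double (a : ℕ) : ℕ → Prog
  | 0 => .skip
  | k + 1 => .seq (double a k) (.add a a a)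

theorem ends_double {Q : Local → Prop} {a : ℕ} (k : ℕ) {s : Local}
    (h : Q (s.write a (2 ^ k * s.mem a))) : Ends (double a k) (2 * k + 1) Q s := by
  induction k generalizing Q with
  | zero =>
    refine ends_skip ?_
    simpa [Local.write] using h
  | succ k ih =>
    refine (ends_seq (ih (ends_add ?_))).mono (by omega) fun _ h => h
    convert h using 1
    simp [Local.write, pow_succ]
    ring_nf

/-- Appends `m` bits to the binary representation of `x`. -/
def appendBits (x : ℕ) (f : ℕ → Bool) : ℕ → ℕ
  | 0 => x
  | m + 1 => 2 * appendBits x f m + (f m).toNat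

/-- Append one random bit to `M[8]` for every multiplication of `M[6]` by `2 ^ k` that is needed to
reach `M[0]`; count them in binary in `M[7]`. -/
def sampleProg (k : ℕ) : Prog :=
  .seq (.const 6 1) <| .seq (.sub 9 0 6) <| .loop 9 <|
    .seq (double 6 k) <| .seq (.add 7 7 7) <| .seq (.add 8 8 8) <| .seq (.flip 10) <|
    .seq (.add 8 8 10) (.sub 9 0 6)

/-- `M[11] :=` the number of ports through which a message equal to `M[3]` has arrived. -/
def countProg : Prog :=
  .seq (.const 11 0) <| .seq (.add 10 2 15) <| .loop 10 <|
    .seq (.sub 10 10 5) <| .seq (.recv 12 10) <| .seq (.sub 13 12 3) <| .seq (.sub 14 3 12) <|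
    .seq (.add 13 13 14) (.ite 13 .skip (.add 11 11 5))

/-- Send `M[3]` to all neighbours. -/
def sendProg : Prog :=
  .seq (.add 10 2 15) <| .loop 10 <| .seq (.sub 10 10 5) (.send 10 3)

/-- The program of every vertex. -/
def colorProg (k d : ℕ) : Prog :=
  .seq (.const 5 1) <| .seq (.const 15 0) <| .seq (.ite 3 .skip (.add 4 4 5)) <|
  .seq (.add 8 4 15) <| .seq (sampleProg d) <| .seq (.const 7 1) <| .seq (sampleProg k) <|
  .seq countProg <| .seq (.sub 13 11 7) <|
  .seq (.ite 3 (.ite 11 (.add 3 8 15) .skip) (.ite 13 .skip (.add 3 8 15))) sendProg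

theorem ends_sampleProg {Q : Local → Prop} {k n : ℕ} (hk : 1 ≤ k) {s : Local} (hn : s.mem 0 = n)
    (h : ∀ s' : Local, (∀ i, i < 6 ∨ 10 < i → s'.mem i = s.mem i) → s'.inbox = s.inbox →
      s'.outbox = s.outbox → (s'.coins = fun j => s.coins (j + Nat.clog (2 ^ k) n)) →
      s'.mem 7 = 2 ^ Nat.clog (2 ^ k) n * s.mem 7 →
      s'.mem 8 = appendBits (s.mem 8) s.coins (Nat.clog (2 ^ k) n) → Q s') :
    Ends (sampleProg k) (n * (2 * k + 20) + 10) Q s := by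
  have hb : 1 < 2 ^ k := Nat.one_lt_pow (by omega) one_lt_two
  -- A crude bound on the number of passes; polynomial time is all that is required.
  have hlog : Nat.clog (2 ^ k) n ≤ n := by
    rw [Nat.clog_le_iff_le_pow hb]
    exact (Nat.lt_pow_self hb).le
  refine Ends.mono (ends_seq <| ends_const <| ends_seq <| ends_sub <|
    ends_loop (m := Nat.clog (2 ^ k) n) (N := 2 * k + 11)
    (fun i s' => (∀ i, i < 6 ∨ 10 < i → s'.mem i = s.mem i) ∧ s'.inbox = s.inbox ∧
      s'.outbox = s.outbox ∧ (s'.coins = fun j => s.coins (j + i)) ∧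
      s'.mem 7 = 2 ^ i * s.mem 7 ∧ s'.mem 8 = appendBits (s.mem 8) s.coins i ∧
      s'.mem 6 = (2 ^ k) ^ i ∧ s'.mem 9 = n - (2 ^ k) ^ i) ?_ ?_ ?_ ?_)
      (N := 1 + (1 + (Nat.clog (2 ^ k) n * (2 * k + 11 + 1) + 1) + 1) + 1) ?_ fun _ h => h
  · rintro i hi s' ⟨h1, h2, h3, h4, h5, h6, h7, h8⟩
    refine ⟨?_, ?_⟩
    · have := (Nat.lt_clog_iff_pow_lt hb).1 hi
      omega
    · refine Ends.mono (ends_seq <| ends_double _ <| ends_seq <| ends_add <| ends_seq <| ends_add <|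
        ends_seq <| ends_flip <| ends_seq <| ends_add <| ends_sub
          (Q := fun s' => (∀ i, i < 6 ∨ 10 < i → s'.mem i = s.mem i) ∧ s'.inbox = s.inbox ∧
      s'.outbox = s.outbox ∧ (s'.coins = fun j => s.coins (j + (i + 1))) ∧
      s'.mem 7 = 2 ^ (i + 1) * s.mem 7 ∧ s'.mem 8 = appendBits (s.mem 8) s.coins (i + 1) ∧
      s'.mem 6 = (2 ^ k) ^ (i + 1) ∧ s'.mem 9 = n - (2 ^ k) ^ (i + 1)) ?_)
        (by omega) fun _ h => h
      have h0 := h1 0 (by omega)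
      simp only [Local.write, Function.update_apply]
      simp only [h2, h3, h4, h5, h6, h7, h0, hn]
      refine ⟨fun j hj => ?_, trivial, trivial, ?_, ?_, ?_, ?_, ?_⟩
      · rw [← h1 j hj]
        repeat rw [if_neg (by omega)]
      · funext j; congr 1; omega
      · simp; ring
      · simp [appendBits]; ring
      · simp; ring
      · simp; ring_nf
  · rintro s' ⟨-, -, -, -, -, -, -, h8⟩
    have := (Nat.clog_le_iff_le_pow hb (x := n)).1 le_rfl
    omega
  · simp only [Local.write, Function.update_apply]
    refine ⟨fun j hj => ?_, trivial, trivial, rfl, ?_, ?_, ?_, ?_⟩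
    · repeat rw [if_neg (by omega)]
    · simp
    · simp [appendBits]
    · simp
    · simp [hn]
  · rintro s' ⟨h1, h2, h3, h4, h5, h6, -, -⟩
    exact h s' h1 h2 h3 h4 h5 h6
  · have := Nat.mul_le_mul_right (2 * k + 20) hlog
    nlinarith

/-- Two numbers are equal iff their two truncated differences add up to `0`. The ports are scanned
downwards, so `i` passes have treated the ports in `Ico (d - i) d`. -/
theorem ends_countProg {Q : Local → Prop} {s : Local} {d : ℕ} (hd : s.mem 2 = d)
    (h5 : s.mem 5 = 1) (h15 : s.mem 15 = 0)
    (h : ∀ s' : Local, (∀ i, i < 10 ∨ 14 < i → s'.mem i = s.mem i) → s'.inbox = s.inbox →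
      s'.outbox = s.outbox →
      s'.mem 11 = ((Finset.range d).filter fun i => s.inbox i = s.mem 3).card → Q s') :
    Ends countProg (d * 20 + 10) Q s := by
  refine Ends.mono (ends_seq <| ends_const <| ends_seq <| ends_add <|
    ends_loop (m := d) (N := 14)
    (fun i s' => (∀ i, i < 10 ∨ 14 < i → s'.mem i = s.mem i) ∧ s'.inbox = s.inbox ∧
      s'.outbox = s.outbox ∧ s'.mem 10 = d - i ∧
      s'.mem 11 = ((Finset.Ico (d - i) d).filter fun i => s.inbox i = s.mem 3).card) ?_ ?_ ?_ ?_)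
      (N := 1 + (1 + (d * (14 + 1) + 1) + 1) + 1) (by omega) fun _ h => h
  · rintro i hi s' ⟨h1, h2, h3, h4, h6⟩
    refine ⟨by omega, ?_⟩
    have e3 := h1 3 (by omega)
    have e5 := h1 5 (by omega)
    have key : Finset.Ico (d - (i + 1)) d = insert (d - (i + 1)) (Finset.Ico (d - i) d) := by
      ext j; simp only [Finset.mem_Ico, Finset.mem_insert]; omega
    have e10 : d - i - 1 = d - (i + 1) := by omega
    refine Ends.mono (ends_seq <| ends_sub <| ends_seq <| ends_recv <| ends_seq <| ends_sub <|
        ends_seq <| ends_sub <| ends_seq <| ends_add <| ends_ite (N := 1)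
          (Q := fun s' => (∀ i, i < 10 ∨ 14 < i → s'.mem i = s.mem i) ∧ s'.inbox = s.inbox ∧
      s'.outbox = s.outbox ∧ s'.mem 10 = d - (i + 1) ∧
      s'.mem 11 =
        ((Finset.Ico (d - (i + 1)) d).filter fun i => s.inbox i = s.mem 3).card) ?_ ?_)
        (by omega) fun _ h => h
    · intro hne
      refine ends_skip ?_
      simp only [Local.write, Function.update_apply] at hne ⊢
      simp [h2, h4, e3, e5, h5, e10] at hne
      refine ⟨fun j hj => ?_, h2, h3, ?_, ?_⟩
      · rw [← h1 j hj]
        repeat rw [if_neg (by omega)]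
      · simp [h4, e5, h5, e10]
      · rw [key, Finset.filter_insert,
          if_neg (show ¬ s.inbox (d - (i + 1)) = s.mem 3 by omega)]
        simpa using h6
    · intro heq
      refine ends_add ?_
      simp only [Local.write, Function.update_apply] at heq ⊢
      simp [h2, h4, e3, e5, h5, e10] at heq
      refine ⟨fun j hj => ?_, h2, h3, ?_, ?_⟩
      · rw [← h1 j hj]
        repeat rw [if_neg (by omega)]
      · simp [h4, e5, h5, e10]
      · rw [key, Finset.filter_insert,
          if_pos (show s.inbox (d - (i + 1)) = s.mem 3 by omega), Finset.card_insert_of_notMem]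
        · simp [h6, e5, h5]
        · simp only [Finset.mem_filter, Finset.mem_Ico]; omega
  · rintro s' ⟨-, -, -, h4, -⟩
    omega
  · simp only [Local.write, Function.update_apply]
    refine ⟨fun j hj => ?_, trivial, trivial, ?_, ?_⟩
    · repeat rw [if_neg (by omega)]
    · simp [hd, h15]
    · simp
  · rintro s' ⟨h1, h2, h3, -, h6⟩
    refine h s' h1 h2 h3 ?_
    rw [h6, Nat.sub_self, Finset.range_eq_Ico]

theorem ends_sendProg {Q : Local → Prop} {s : Local} {d : ℕ} (hd : s.mem 2 = d)
    (h5 : s.mem 5 = 1) (h15 : s.mem 15 = 0)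
    (h : ∀ s' : Local, (∀ i, i ≠ 10 → s'.mem i = s.mem i) →
      (∀ i < d, s'.outbox i = s.mem 3) → Q s') :
    Ends sendProg (d * 20 + 10) Q s := by
  refine Ends.mono (ends_seq <| ends_add <|
    ends_loop (m := d) (N := 3)
    (fun i s' => (∀ i, i ≠ 10 → s'.mem i = s.mem i) ∧ s'.mem 10 = d - i ∧
      ∀ j, d - i ≤ j → j < d → s'.outbox j = s.mem 3) ?_ ?_ ?_ ?_)
      (N := 1 + (d * (3 + 1) + 1) + 1) (by omega) fun _ h => h
  · rintro i hi s' ⟨h1, h4, h6⟩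
    refine ⟨by omega, ends_seq <| ends_sub <| ends_send ?_⟩
    have e3 := h1 3 (by omega)
    have e5 := h1 5 (by omega)
    simp only [Local.write, Function.update_apply]
    refine ⟨fun j hj => ?_, ?_, fun j hj hj' => ?_⟩
    · rw [if_neg hj, h1 j hj]
    · simp only [if_true, h4, e5, h5]; omega
    · simp only [if_true, h4, e5, h5, e3, if_neg (show (3 : ℕ) ≠ 10 by omega)]
      split_ifs with hc
      · rfl
      · exact h6 j (by omega) hj'
  · rintro s' ⟨-, h4, -⟩
    omega
  · simp only [Local.write, Function.update_apply]
    refine ⟨fun j hj => if_neg hj, ?_, fun j hj hj' => by omega⟩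
    simp [hd, h15]
  · rintro s' ⟨h1, -, h6⟩
    exact h s' h1 fun i hi => h6 i (by omega) hi

theorem appendBits_add (x : ℕ) (f : ℕ → Bool) (l m : ℕ) :
    appendBits (appendBits x f l) (fun j => f (j + l)) m = appendBits x f (l + m) := by
  induction m with
  | zero => rfl
  | succ m ih => rw [← add_assoc, appendBits, ih, appendBits, add_comm m l]

/-- Since `0` encodes "still alive", one count `N` of messages equal to the own colour serves both
phases: for an alive vertex it is the remaining degree, for a coloured one the number of clashes. -/
theorem ends_colorProg {k d n e l c : ℕ} (hk : 1 ≤ k) (hd : 1 ≤ d) {s : Local}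
    (h0 : s.mem 0 = n) (h2 : s.mem 2 = e) (he : e ≤ n) (h3 : s.mem 3 = c) (h4 : s.mem 4 = l) :
    Ends (colorProg k d) (n * (2 * k + 2 * d + 80) + 100)
      (fun s' => s'.mem 0 = n ∧ s'.mem 2 = e ∧
        s'.mem 4 = (if c = 0 then l + 1 else l) ∧
        (∀ x N, x = appendBits (if c = 0 then l + 1 else l) s.coins
            (Nat.clog (2 ^ d) n + Nat.clog (2 ^ k) n) →
          N = ((Finset.range e).filter fun i => s.inbox i = c).card →
          s'.mem 3 = if c = 0 then (if N ≤ 2 ^ Nat.clog (2 ^ k) n then x else 0)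
            else (if N = 0 then c else x)) ∧
        ∀ i < e, s'.outbox i = s'.mem 3) s := by
  set Q : Local → Prop := (fun s' => s'.mem 0 = n ∧ s'.mem 2 = e ∧
        s'.mem 4 = (if c = 0 then l + 1 else l) ∧
        (∀ x N, x = appendBits (if c = 0 then l + 1 else l) s.coins
            (Nat.clog (2 ^ d) n + Nat.clog (2 ^ k) n) →
          N = ((Finset.range e).filter fun i => s.inbox i = c).card →
          s'.mem 3 = if c = 0 then (if N ≤ 2 ^ Nat.clog (2 ^ k) n then x else 0)
            else (if N = 0 then c else x)) ∧
        ∀ i < e, s'.outbox i = s'.mem 3) with hQ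
  -- Both branches of the first conditional continue with the same remainder, which is verified
  -- once.
  have hinit : ∀ s₁ : Local, (∀ i, i < 4 → s₁.mem i = s.mem i) → s₁.mem 5 = 1 → s₁.mem 15 = 0 →
      s₁.mem 4 = (if c = 0 then l + 1 else l) → s₁.inbox = s.inbox → s₁.coins = s.coins →
      Ends (.seq (.add 8 4 15) <| .seq (sampleProg d) <| .seq (.const 7 1) <|
        .seq (sampleProg k) <| .seq countProg <| .seq (.sub 13 11 7) <|
        .seq (.ite 3 (.ite 11 (.add 3 8 15) .skip) (.ite 13 .skip (.add 3 8 15))) sendProg)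
        (n * (2 * k + 2 * d + 80) + 80) Q s₁ := by
    intro s₁ f1 f5 f15 f4 fi fc
    refine Ends.mono (ends_seq <| ends_add <| ends_seq <| ends_sampleProg hd
      (n := n) (by simp [Local.write, f1, h0]) fun s₂ g1 gi go gc g7 g8 =>
        ends_seq <| ends_const <| ends_seq <| ends_sampleProg hk (n := n) (by
          simp [Local.write, g1, f1, h0]) fun s₃ k1 ki ko kc k7 k8 =>
          ends_seq <| ends_countProg (d := e) (by simp [Local.write, k1, g1, f1, h2])
            (by simp [Local.write, k1, g1, f5]) (by simp [Local.write, k1, g1, f15])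
            fun s₄ m1 mi mo m11 => ends_seq <| ends_sub (Q := Ends _ (e * 20 + 15) Q) ?_) (N := 1 +
             (n * (2 * d + 20) + 10 + (1 + (n * (2 * k + 20) + 10 +
              (e * 20 + 10 + (1 + (e * 20 + 15) + 1) + 1) + 1) + 1) + 1) + 1)
              (by nlinarith) fun _ h => h
    simp only [Local.write] at g1 gi gc g7 g8 k1 ki kc k7 k8
    simp only [Function.update_self] at g1 g8
    have a8 : s₄.mem 8 = appendBits (if c = 0 then l + 1 else l) s.coins
            (Nat.clog (2 ^ d) n + Nat.clog (2 ^ k) n) := by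
      rw [m1 8 (by omega), k8, gc, ← appendBits_add]
      simp [g8, fc, f4, f15]
    have a7 : s₄.mem 7 = 2 ^ Nat.clog (2 ^ k) n := by
      rw [m1 7 (by omega), k7]; simp
    have a11 : s₄.mem 11 = ((Finset.range e).filter fun i => s.inbox i = c).card := by
      rw [m11, ki, gi, fi, k1 3 (by omega)]
      simp [g1, f1, h3]
    have b : ∀ i, i < 6 ∨ i = 15 → s₄.mem i = s₁.mem i := by
      intro i hi
      rw [m1 i (by omega), k1 i (by omega), Function.update_of_ne (by omega), g1 i (by omega),
        Function.update_of_ne (by omega)]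
    have b0 : s₄.mem 0 = n := by rw [b 0 (by omega), f1 0 (by omega), h0]
    have b2 : s₄.mem 2 = e := by rw [b 2 (by omega), f1 2 (by omega), h2]
    have b3 : s₄.mem 3 = c := by rw [b 3 (by omega), f1 3 (by omega), h3]
    have b4 := (b 4 (by omega)).trans f4
    have b5 := (b 5 (by omega)).trans f5
    have b15 := (b 15 (by omega)).trans f15
    generalize hx : appendBits (if c = 0 then l + 1 else l) s.coins
            (Nat.clog (2 ^ d) n + Nat.clog (2 ^ k) n) = x at *
    generalize hN : ((Finset.range e).filter fun i => s.inbox i = c).card = N at *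
    refine Ends.mono (ends_seq (ends_ite (N := 2) ?_ ?_)) (N := 2 + 1 + (e * 20 + 10) + 1)
      (by omega) fun _ h => h
    all_goals
      intro hc
      refine ends_ite (N := 1) ?_ ?_
    all_goals
      intro hc'
      first
      | refine ends_add ?_
      | refine ends_skip ?_
      simp only [Local.write] at hc hc' ⊢
      simp (disch := omega) only [Function.update_of_ne, Function.update_self, a7, a8, a11,
        b3, b15] at hc hc' ⊢
      refine ends_sendProg (d := e) (by simp [b2]) (by simp [b5]) (by simp [b15])
        fun s' q1 q2 => ?_
      rw [hQ]
      refine ⟨by simp [q1, b0], by simp [q1, b2], by simp [q1, b4], ?_,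
        fun i hi => by rw [q2 i hi, q1 3 (by omega)]⟩
      rintro _ _ rfl rfl
      rw [q1 3 (by omega)]
    · simp [hc, hc']
    · simp [hc, hc', b3]
    · rw [if_pos hc, if_neg (by omega)]; simp [b3, hc]
    · rw [if_pos hc, if_pos (by omega)]; simp
  refine Ends.mono (ends_seq <| ends_const <| ends_seq <| ends_const <| ends_seq <|
    ends_ite (N := 1) (Q := Ends _ (n * (2 * k + 2 * d + 80) + 80) Q) ?_ ?_)
    (N := 1 + (1 + (1 + 1 + (n * (2 * k + 2 * d + 80) + 80) + 1) + 1) + 1) (by omega) fun _ h => h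
  · intro hc
    refine ends_skip (hinit _ ?_ ?_ ?_ ?_ rfl rfl)
    · intro i hi
      simp (disch := omega) [Local.write, Function.update_of_ne]
    · simp [Local.write]
    · simp [Local.write]
    · simp [Local.write, h3] at hc
      simp [Local.write, hc, h4]
  · intro hc
    refine ends_add (hinit _ ?_ ?_ ?_ ?_ rfl rfl)
    · intro i hi
      simp (disch := omega) [Local.write, Function.update_of_ne]
    · simp [Local.write]
    · simp [Local.write]
    · simp [Local.write, h3] at hc
      simp [Local.write, hc, h4]

/-! ### Peeling a graph of large girth -/

/-- Two short paths with the same ends in a graph of large girth are equal. -/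
theorem path_unique_of_lt_egirth {V : Type*} {G : SimpleGraph V} {u v : V} {p q : G.Walk u v}
    (hp : p.IsPath) (hq : q.IsPath) (h : ((p.length + q.length : ℕ) : ℕ∞) < G.egirth) : p = q := by
  -- The union of the two paths has too few edges to contain a cycle of `G`, so it is a forest,
  -- where paths are unique.
  set H : SimpleGraph V := SimpleGraph.fromEdgeSet {e | e ∈ p.edges ∨ e ∈ q.edges} with hH
  have hmem : ∀ e, e ∈ H.edgeSet ↔ e ∈ p.edges ∨ e ∈ q.edges := by
    intro e
    rw [hH, SimpleGraph.edgeSet_fromEdgeSet]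
    refine ⟨fun h => h.1, fun h => ⟨h, fun hd => ?_⟩⟩
    exact G.not_isDiag_of_mem_edgeSet
      (h.elim (fun h => p.edges_subset_edgeSet h) fun h => q.edges_subset_edgeSet h) hd
  have hle : H ≤ G := by
    rw [← SimpleGraph.edgeSet_subset_edgeSet]
    intro e he
    exact ((hmem e).1 he).elim (fun h => p.edges_subset_edgeSet h) fun h => q.edges_subset_edgeSet h
  have hac : H.IsAcyclic := by
    intro x w hw
    have h1 : w.length ≤ p.length + q.length := by
      rw [← w.length_edges, ← p.length_edges, ← q.length_edges, ← List.length_append]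
      refine (List.subperm_of_subset hw.isCircuit.isTrail.edges_nodup fun e he => ?_).length_le
      rw [List.mem_append]
      exact (hmem e).1 (w.edges_subset_edgeSet he)
    have h2 := SimpleGraph.egirth_le_length (hw.mapLe hle)
    rw [SimpleGraph.Walk.length_map] at h2
    exact absurd (h2.trans (by exact_mod_cast h1)) (not_le.2 h)
  have hp' : ∀ e ∈ p.edges, e ∈ H.edgeSet := fun e he => (hmem e).2 (Or.inl he)
  have hq' : ∀ e ∈ q.edges, e ∈ H.edgeSet := fun e he => (hmem e).2 (Or.inr he)
  have := congrArg Subtype.val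
    ((hac.subsingleton_path u v).elim ⟨p.transfer H hp', hp.transfer hp'⟩
      ⟨q.transfer H hq', hq.transfer hq'⟩)
  have := congrArg SimpleGraph.Walk.support this
  rw [SimpleGraph.Walk.support_transfer, SimpleGraph.Walk.support_transfer] at this
  exact SimpleGraph.Walk.ext_support this

/-- By uniqueness of short paths, the part of `p` from `z` to `y` is the single edge `zy`. -/
theorem eq_penultimate_of_mem_support {V : Type*} {G : SimpleGraph V} {x y z : V}
    {p : G.Walk x y} (hp : p.IsPath) (h : G.Adj z y) (hz : z ∈ p.support) (hg : ((p.length + 1 : ℕ) : ℕ∞) < G.egirth) :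
    z = p.penultimate := by
  classical
  have h1 : p.dropUntil z hz = .cons h .nil := by
    refine path_unique_of_lt_egirth (hp.dropUntil hz) (by simp [h.ne]) (lt_of_le_of_lt ?_ hg)
    have := p.length_dropUntil_le_length hz
    simp only [SimpleGraph.Walk.length_cons, SimpleGraph.Walk.length_nil]
    exact_mod_cast (by omega)
  have h2 : p = (p.takeUntil z hz).concat h := by
    rw [SimpleGraph.Walk.concat_eq_append, ← h1, SimpleGraph.Walk.take_spec]
  rw [h2, SimpleGraph.Walk.penultimate_concat]

section

variable {V : Type*} [Fintype V]

open Classical in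
/-- The vertices that remain after `r` rounds, in each of which all vertices with at most `A`
remaining neighbours are removed simultaneously. -/
noncomputable def alive (G : SimpleGraph V) (A : ℕ) : ℕ → Finset V
  | 0 => Finset.univ
  | r + 1 => (alive G A r).filter fun v =>
      A < (Finset.univ.filter fun w => G.Adj v w ∧ w ∈ alive G A r).card

variable {G : SimpleGraph V} {A : ℕ}

theorem mem_alive_succ {r : ℕ} {v : V} [DecidablePred fun w => G.Adj v w ∧ w ∈ alive G A r] :
    v ∈ alive G A (r + 1) ↔ v ∈ alive G A r ∧
      A < (Finset.univ.filter fun w => G.Adj v w ∧ w ∈ alive G A r).card := by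
  rw [alive, Finset.mem_filter]
  congr!

theorem alive_antitone : Antitone (alive G A) :=
  antitone_nat_of_succ_le fun _ => Finset.filter_subset _ _

open Classical in
/-- The ends of the paths of length `i` that start at `x`. -/
noncomputable def pathEnds (G : SimpleGraph V) (x : V) (i : ℕ) : Finset V :=
  Finset.univ.filter fun y => ∃ p : G.Walk x y, p.IsPath ∧ p.length = i

-- One layer of the tree: each `y` has more than `A` neighbours that survived one round less, and
-- all but at most one of them extend the path to `y`. Different `y` yield different extensions,
-- because paths of length `i + 1 ≤ K` with the same ends coincide.
open Classical in
theorem card_pathEnds_succ {K i : ℕ} {x : V} (hi : i + 1 ≤ K)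
    (hg : ((2 * K : ℕ) : ℕ∞) < G.egirth) :
    (pathEnds G x i ∩ alive G A (K - i)).card * A ≤
      (pathEnds G x (i + 1) ∩ alive G A (K - (i + 1))).card := by
  set N : V → Finset V := fun y => Finset.univ.filter fun z =>
    (G.Adj y z ∧ z ∈ alive G A (K - (i + 1))) ∧
      ∃ p : G.Walk x y, p.IsPath ∧ p.length = i ∧ z ∉ p.support with hN
  have hcard : ∀ y ∈ pathEnds G x i ∩ alive G A (K - i), A ≤ (N y).card := by
    intro y hy
    obtain ⟨hy, hya⟩ := Finset.mem_inter.1 hy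
    obtain ⟨p, hp, hpi⟩ := (Finset.mem_filter.1 hy).2
    have hK : K - i = K - (i + 1) + 1 := by omega
    rw [hK, mem_alive_succ] at hya
    refine (Nat.le_pred_of_lt hya.2).trans (Finset.pred_card_le_card_erase.trans
      (Finset.card_le_card (s := Finset.erase _ p.penultimate) fun z hz => ?_))
    rw [Finset.mem_erase, Finset.mem_filter] at hz
    refine Finset.mem_filter.2 ⟨Finset.mem_univ _, hz.2.2, p, hp, hpi, fun hzp => hz.1 ?_⟩
    refine eq_penultimate_of_mem_support hp hz.2.2.1.symm hzp (lt_of_le_of_lt ?_ hg)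
    exact_mod_cast (by omega)
  have hlen : ((i + 1 + (i + 1) : ℕ) : ℕ∞) < G.egirth :=
    lt_of_le_of_lt (by exact_mod_cast (by omega)) hg
  have hdisj : Set.PairwiseDisjoint
      (↑(pathEnds G x i ∩ alive G A (K - i)) : Set V) N := by
    intro y _ y' _ hne
    refine Finset.disjoint_left.2 fun z hz hz' => hne ?_
    obtain ⟨⟨h, -⟩, p, hp, hpi, hzp⟩ := (Finset.mem_filter.1 hz).2
    obtain ⟨⟨h', -⟩, p', hp', hpi', hzp'⟩ := (Finset.mem_filter.1 hz').2
    have := path_unique_of_lt_egirth (hp.concat hzp h) (hp'.concat hzp' h')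
      (by simpa [hpi, hpi'] using hlen)
    rw [← SimpleGraph.Walk.penultimate_concat p h, this, SimpleGraph.Walk.penultimate_concat]
  calc _ ≤ ∑ y ∈ pathEnds G x i ∩ alive G A (K - i), (N y).card := by
        rw [← smul_eq_mul]
        exact Finset.card_nsmul_le_sum _ _ _ hcard
    _ = ((pathEnds G x i ∩ alive G A (K - i)).biUnion N).card := (Finset.card_biUnion hdisj).symm
    _ ≤ _ := by
        refine Finset.card_le_card fun z hz => ?_
        obtain ⟨y, -, hz⟩ := Finset.mem_biUnion.1 hz
        obtain ⟨⟨h, hza⟩, p, hp, hpi, hzp⟩ := (Finset.mem_filter.1 hz).2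
        exact Finset.mem_inter.2 ⟨Finset.mem_filter.2 ⟨Finset.mem_univ _, p.concat h,
          hp.concat hzp h, by simp [hpi]⟩, hza⟩

/-- A graph of girth greater than `2 K` loses all its vertices within `K` rounds. -/
theorem alive_eq_empty {K : ℕ} (hK : 1 ≤ K) (hA : Fintype.card V ≤ A ^ K)
    (hg : ((2 * K : ℕ) : ℕ∞) < G.egirth) : alive G A K = ∅ := by
  classical
  by_contra hne
  obtain ⟨x, hx⟩ := Finset.nonempty_iff_ne_empty.2 hne
  have key : ∀ i ≤ K, A ^ i ≤ (pathEnds G x i ∩ alive G A (K - i)).card := by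
    intro i
    induction i with
    | zero =>
      intro _
      rw [pow_zero, Nat.one_le_iff_ne_zero, Finset.card_ne_zero]
      exact ⟨x, Finset.mem_inter.2 ⟨Finset.mem_filter.2 ⟨Finset.mem_univ _, .nil, by simp⟩, hx⟩⟩
    | succ i ih =>
      intro hi
      rw [pow_succ]
      exact (Nat.mul_le_mul_right _ (ih (by omega))).trans (card_pathEnds_succ hi hg)
  -- The root is not a leaf; this makes the count strict, so that `n ≤ A ^ K` suffices.
  have hxK : x ∉ pathEnds G x K := by
    intro h
    obtain ⟨p, hp, hpK⟩ := (Finset.mem_filter.1 h).2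
    have := SimpleGraph.Walk.length_eq_zero_iff.2 (SimpleGraph.Walk.isPath_iff_nil.1 hp)
    omega
  have h1 := (key K le_rfl).trans (Finset.card_le_card Finset.inter_subset_left)
  have h2 := Finset.card_lt_card (Finset.ssubset_univ_iff.2
    (ne_of_mem_of_not_mem' (Finset.mem_univ x) hxK).symm)
  rw [Finset.card_univ] at h2
  omega

end

/-! ### Fair coins and strings of random bits -/

open MeasureTheory

theorem measurePreserving_xor (b : Bool) :
    MeasurePreserving (fun a : Bool => xor a b) (PMF.uniformOfFintype Bool).toMeasure
      (PMF.uniformOfFintype Bool).toMeasure := by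
  refine ⟨measurable_of_countable _, ?_⟩
  rw [PMF.toMeasure_map _ _ (measurable_of_countable _)]
  congr 1
  ext a
  rw [PMF.map_apply, tsum_fintype]
  cases a <;> cases b <;> simp

/-- Flipping a fixed set of coins preserves the distribution. -/
theorem measurePreserving_mask {n : ℕ} (M : Coins n) :
    MeasurePreserving (fun (ω : Coins n) i => xor (ω i) (M i)) (coinMeasure n) (coinMeasure n) := by
  refine ⟨by fun_prop, ?_⟩
  rw [coinMeasure, Measure.infinitePi_map_pi (f := fun i a => xor a (M i)) _ fun i => by fun_prop]
  congr 1
  funext i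
  exact (measurePreserving_xor (M i)).map_eq

theorem appendBits_injective {x : ℕ} {f g : ℕ → Bool} {t : ℕ}
    (h : appendBits x f t = appendBits x g t) : ∀ j < t, f j = g j := by
  induction t with
  | zero => simp
  | succ t ih =>
    rw [appendBits, appendBits] at h
    have h1 := Bool.toNat_le (f t)
    have h2 := Bool.toNat_le (g t)
    intro j hj
    rcases Nat.lt_succ_iff_lt_or_eq.1 hj with hj | rfl
    · exact ih (by omega) j hj
    · have : (f j).toNat = (g j).toNat := by omega
      cases hf : f j <;> cases hg : g j <;> simp_all

/-- The level can be read off the colour, whatever the random bits. -/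
theorem appendBits_div (x : ℕ) (f : ℕ → Bool) (t : ℕ) : appendBits x f t / 2 ^ t = x := by
  induction t with
  | zero => simp [appendBits]
  | succ t ih =>
    have := Bool.toNat_le (f t)
    rw [pow_succ', ← Nat.div_div_eq_div_mul, appendBits,
      show (2 * appendBits x f t + (f t).toNat) / 2 = appendBits x f t by omega, ih]

/-- Levels are positive when used as prefixes, which keeps the colour `0` free as the mark of an
alive vertex. -/
theorem appendBits_pos {x : ℕ} (hx : 0 < x) (f : ℕ → Bool) (t : ℕ) : 0 < appendBits x f t := by
  rcases Nat.eq_zero_or_pos (appendBits x f t) with h | h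
  · have := appendBits_div x f t
    rw [h, Nat.zero_div] at this
    omega
  · exact h

/-! ### The colouring process and its clash probability -/

section

variable {n : ℕ} (G : SimpleGraph (Fin n)) (A t : ℕ)

open Classical in
/-- The number of rounds, among the first `r` ones, that `v` begins alive. -/
noncomputable def level : ℕ → Fin n → ℕ
  | 0, _ => 0
  | r + 1, v => if v ∈ alive G A r then level r v + 1 else level r v

open Classical in
/-- The colours after `r` local computations; `0` stands for uncoloured. -/
noncomputable def color (ω : Coins n) : ℕ → Fin n → ℕ
  | 0, _ => 0
  | r + 1, v =>
      if v ∈ alive G A r then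
        if v ∈ alive G A (r + 1) then 0
        else appendBits (level G A (r + 1) v) (fun j => ω (v, r, j)) t
      else if ∃ w, G.Adj v w ∧ color ω r w = color ω r v then
        appendBits (level G A (r + 1) v) (fun j => ω (v, r, j)) t
      else color ω r v

/-- The event that `v` has the same colour as one of its neighbours. -/
def conflict (r : ℕ) (v : Fin n) : Set (Coins n) :=
  {ω | ∃ w, G.Adj v w ∧ color G A t ω r w = color G A t ω r v}

variable {G A t}

/-- The sets `alive G A i` decrease, so the rounds that `level` counts form an initial segment. -/
theorem lt_level_iff {r i : ℕ} {v : Fin n} : i < level G A r v ↔ i < r ∧ v ∈ alive G A i := by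
  induction r generalizing i with
  | zero => simp [level]
  | succ r ih =>
    rw [level]
    split_ifs with h
    · have hr : ∀ i ≤ r, v ∈ alive G A i := fun i hi => alive_antitone hi h
      have h1 : r ≤ level G A r v := by
        by_contra hlt
        exact lt_irrefl _ (ih.2 ⟨not_le.1 hlt, hr _ (not_le.1 hlt).le⟩)
      have h2 : ¬ r < level G A r v := fun hlt => lt_irrefl _ (ih.1 hlt).1
      constructor
      · exact fun hi => ⟨by omega, hr i (by omega)⟩
      · exact fun hi => by omega
    · rw [ih]
      constructor
      · exact fun hi => ⟨by omega, hi.2⟩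
      · rintro ⟨hi, hv⟩
        rcases Nat.lt_succ_iff_lt_or_eq.1 hi with hi | rfl
        · exact ⟨hi, hv⟩
        · exact absurd hv h

theorem level_le (r : ℕ) (v : Fin n) : level G A r v ≤ r := by
  by_contra h
  exact lt_irrefl _ (lt_level_iff.1 (not_le.1 h)).1

theorem level_pos (r : ℕ) (v : Fin n) : 0 < level G A (r + 1) v :=
  lt_level_iff.2 ⟨by omega, Finset.mem_univ _⟩

theorem color_eq_zero_iff {ω : Coins n} {r : ℕ} {v : Fin n} :
    color G A t ω r v = 0 ↔ v ∈ alive G A r := by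
  induction r with
  | zero => simp [color, alive]
  | succ r ih =>
    have hp := (appendBits_pos (level_pos (G := G) (A := A) r v) (fun j => ω (v, r, j)) t).ne'
    have hs : v ∈ alive G A (r + 1) → v ∈ alive G A r := fun h => alive_antitone r.le_succ h
    rw [color]
    split_ifs with h1 h2 h3
    · simp [h2]
    · simp [h2, hp]
    · simp [hp, mt hs h1]
    · rw [ih]
      exact ⟨fun h => absurd h h1, hs⟩

theorem color_div {ω : Coins n} {r : ℕ} {v : Fin n} (hv : v ∉ alive G A r) :
    color G A t ω r v / 2 ^ t = level G A r v := by
  induction r with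
  | zero => exact absurd (Finset.mem_univ v) hv
  | succ r ih =>
    rw [color]
    split_ifs with h1 h2
    · exact appendBits_div _ _ _
    · exact appendBits_div _ _ _
    · rw [ih h1, level, if_neg h1]

theorem color_lt (ω : Coins n) (r : ℕ) (v : Fin n) :
    color G A t ω r v < (r + 1) * 2 ^ t := by
  by_cases hv : v ∈ alive G A r
  · rw [color_eq_zero_iff.2 hv]
    positivity
  · rw [← Nat.div_lt_iff_lt_mul (by positivity), color_div hv]
    exact Nat.lt_succ_of_le (level_le r v)

/-- Coins of round `r` or later do not influence the colours that exist before it; this is the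
independence used in `measure_hit_le`. -/
theorem color_congr {ω ω' : Coins n} {r : ℕ}
    (h : ∀ r' < r, ∀ v j, ω (v, r', j) = ω' (v, r', j)) :
    color G A t ω r = color G A t ω' r := by
  induction r with
  | zero => rfl
  | succ r ih =>
    funext v
    rw [color, color, ih fun r' hr' => h r' (by omega)]
    simp only [h r (by omega)]

theorem measurable_color (r : ℕ) : Measurable fun ω : Coins n => color G A t ω r := by
  have hbits : ∀ (x : ℕ) (v : Fin n) (r m : ℕ),
      Measurable fun ω : Coins n => appendBits x (fun j => ω (v, r, j)) m := by
    intro x v r m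
    induction m with
    | zero => exact measurable_const
    | succ m ih =>
      simp only [appendBits]
      exact (ih.const_mul 2).add
        ((measurable_of_countable Bool.toNat).comp (measurable_pi_apply (v, r, m)))
  induction r with
  | zero => exact measurable_const
  | succ r ih =>
    classical
    -- The new colours are a function of the old colours and the new strings, which range over a
    -- countable space.
    have : (fun ω : Coins n => color G A t ω (r + 1)) =
        (fun z : (Fin n → ℕ) × (Fin n → ℕ) => fun v =>
          if v ∈ alive G A r then if v ∈ alive G A (r + 1) then 0 else z.2 v
          else if ∃ w, G.Adj v w ∧ z.1 w = z.1 v then z.2 v else z.1 v) ∘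
        fun ω => (color G A t ω r,
          fun v => appendBits (level G A (r + 1) v) (fun j => ω (v, r, j)) t) := by
      funext ω v
      simp only [Function.comp, color]
    rw [this]
    exact (measurable_of_countable _).comp
      (ih.prodMk (measurable_pi_iff.2 fun v => hbits _ v r t))

theorem measurableSet_conflict (r : ℕ) (v : Fin n) : MeasurableSet (conflict G A t r v) :=
  measurable_color (G := G) (A := A) (t := t) r
    (Set.to_countable {z : Fin n → ℕ | ∃ w, G.Adj v w ∧ z w = z v}).measurableSet

-- If `v` has level `d + 1`, it was deleted in round `d` with at most `A` neighbours alive, and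
-- every neighbour on the same level was alive then.
open Classical in
theorem card_level_eq_le {r : ℕ} (hr : alive G A r = ∅) (v : Fin n) :
    (Finset.univ.filter fun w => G.Adj v w ∧ level G A r w = level G A r v).card ≤ A := by
  obtain ⟨d, hd⟩ : ∃ d, level G A r v = d + 1 := by
    refine Nat.exists_eq_succ_of_ne_zero fun h => ?_
    have h0 : ¬ 0 < level G A r v := by omega
    rw [lt_level_iff, not_and_or] at h0
    rcases h0 with h0 | h0
    · have : r = 0 := by omega
      subst this
      have := Finset.mem_univ v
      rw [show (Finset.univ : Finset (Fin n)) = ∅ from hr] at this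
      simp at this
    · exact h0 (Finset.mem_univ _)
  have h1 : d < r ∧ v ∈ alive G A d := lt_level_iff.1 (by omega)
  have h2 : v ∉ alive G A (d + 1) := by
    intro h
    rcases (Nat.succ_le_of_lt h1.1).lt_or_eq with h' | h'
    · have := lt_level_iff.2 ⟨h', h⟩
      omega
    · rw [Nat.succ_eq_add_one] at h'
      rw [h', hr] at h
      simp at h
  rw [mem_alive_succ, not_and, not_lt] at h2
  refine (Finset.card_le_card fun w hw => ?_).trans (h2 h1.2)
  rw [Finset.mem_filter] at hw ⊢
  exact ⟨hw.1, hw.2.1, (lt_level_iff.1 (by omega : d < level G A r w)).2⟩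

/-- A new colour hits a given colour with probability at most `2 ^ (-t)`. -/
theorem measure_hit_le {r : ℕ} (hr : alive G A r = ∅) {u w : Fin n} (huw : u ≠ w) :
    2 ^ t * coinMeasure n (conflict G A t r u ∩
      {ω | color G A t ω (r + 1) u = color G A t ω (r + 1) w}) ≤
      coinMeasure n (conflict G A t r u) := by
  classical
  set E := conflict G A t r u ∩ {ω | color G A t ω (r + 1) u = color G A t ω (r + 1) w} with hE
  have hEm : MeasurableSet E :=
    (measurableSet_conflict r u).inter (measurable_color (G := G) (A := A) (t := t) (r + 1)
      (Set.to_countable {z : Fin n → ℕ | z u = z w}).measurableSet)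
  -- XORing the `t` bits of `u` in round `r` with a mask affects neither the old colours nor the new
  -- colour of `w`. At most one mask makes the redrawn colour of `u` equal to that of `w`, so the `2
  -- ^ t` preimages of `E` are disjoint parts of the old clash event, each with the measure of `E`.
  let M : (Fin t → Bool) → Coins n := fun m i =>
    if i.1 = u ∧ i.2.1 = r then (if h : i.2.2 < t then m ⟨i.2.2, h⟩ else false) else false
  let φ : (Fin t → Bool) → Coins n → Coins n := fun m ω i => xor (ω i) (M m i)
  have hφ : ∀ m, MeasurePreserving (φ m) (coinMeasure n) (coinMeasure n) := fun m =>
    measurePreserving_mask (M m)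
  have hold : ∀ m ω, color G A t (φ m ω) r = color G A t ω r := fun m ω =>
    color_congr fun r' hr' v j => by
      simp [φ, M, hr'.ne]
  have hnew : ∀ m ω, color G A t (φ m ω) (r + 1) w = color G A t ω (r + 1) w := by
    intro m ω
    rw [color, color, hold]
    simp [φ, M, huw.symm]
  have hsub : ∀ m, φ m ⁻¹' E ⊆ conflict G A t r u := by
    rintro m ω ⟨⟨x, hx⟩, -⟩
    refine ⟨x, ?_⟩
    rwa [hold] at hx
  have hdisj : Pairwise (Function.onFun Disjoint fun m => φ m ⁻¹' E) := by
    intro m m' hne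
    refine Set.disjoint_left.2 ?_
    rintro ω ⟨h1, h1'⟩ ⟨h2, h2'⟩
    refine hne (funext fun j => ?_)
    have hu : u ∉ alive G A r := by simp [hr]
    have key : ∀ m, φ m ω ∈ conflict G A t r u → color G A t (φ m ω) (r + 1) u =
        appendBits (level G A (r + 1) u) (fun j => φ m ω (u, r, j)) t := by
      intro m hm
      rw [color, if_neg hu]
      exact if_pos hm
    have h3 : color G A t (φ m ω) (r + 1) u = color G A t (φ m' ω) (r + 1) u := by
      rw [h1'.trans (hnew m ω), h2'.trans (hnew m' ω)]
    rw [key m h1, key m' h2] at h3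
    have := appendBits_injective h3 j j.2
    simpa [φ, M] using this
  calc 2 ^ t * coinMeasure n E = ∑ m : Fin t → Bool, coinMeasure n (φ m ⁻¹' E) := by
        simp [(hφ _).measure_preimage hEm.nullMeasurableSet]
    _ = coinMeasure n (⋃ m, φ m ⁻¹' E) := by
        rw [measure_iUnion hdisj fun m => (hφ m).measurable hEm, tsum_fintype]
    _ ≤ _ := measure_mono (Set.iUnion_subset hsub)

/-- If neither end of a monochromatic edge had clashed before, both would have kept their colours
and clashed already. So one end redrew; the factor `2` counts which one, and `A` counts the
neighbours on the level of `v`. -/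
theorem measure_conflict_succ_le {r : ℕ} (hr : alive G A r = ∅) {β : ℝ≥0∞}
    (hβ : ∀ v, coinMeasure n (conflict G A t r v) ≤ β) (v : Fin n) :
    2 ^ t * coinMeasure n (conflict G A t (r + 1) v) ≤ (2 * A) * β := by
  classical
  have hr' : alive G A (r + 1) = ∅ :=
    Finset.subset_empty.1 (hr ▸ alive_antitone (G := G) (A := A) r.le_succ)
  set N := Finset.univ.filter fun w => G.Adj v w ∧ level G A (r + 1) w = level G A (r + 1) v with hN
  set E : Fin n → Fin n → Set (Coins n) := fun u w => conflict G A t r u ∩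
      {ω | color G A t ω (r + 1) u = color G A t ω (r + 1) w} with hE
  have hsub : conflict G A t (r + 1) v ⊆ ⋃ w ∈ N, (E v w ∪ E w v) := by
    rintro ω ⟨w, hvw, hw⟩
    have hl : level G A (r + 1) w = level G A (r + 1) v := by
      rw [← color_div (t := t) (ω := ω), ← color_div (t := t) (ω := ω), hw] <;> simp [hr']
    refine Set.mem_iUnion₂.2 ⟨w, by simp [hN, hvw, hl], ?_⟩
    by_cases h1 : ω ∈ conflict G A t r v
    · exact Or.inl ⟨h1, hw.symm⟩
    by_cases h2 : ω ∈ conflict G A t r w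
    · exact Or.inr ⟨h2, hw⟩
    have stay : ∀ x, ω ∉ conflict G A t r x → color G A t ω (r + 1) x = color G A t ω r x := by
      intro x hx
      rw [color, if_neg (by simp [hr])]
      exact if_neg hx
    rw [stay v h1, stay w h2] at hw
    exact absurd ⟨w, hvw, hw⟩ h1
  calc 2 ^ t * coinMeasure n (conflict G A t (r + 1) v)
      ≤ 2 ^ t * ∑ w ∈ N, (coinMeasure n (E v w) + coinMeasure n (E w v)) := by
        gcongr
        exact (measure_mono hsub).trans ((measure_biUnion_finset_le _ _).trans
          (Finset.sum_le_sum fun w _ => measure_union_le _ _))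
    _ = ∑ w ∈ N, (2 ^ t * coinMeasure n (E v w) + 2 ^ t * coinMeasure n (E w v)) := by
        simp only [Finset.mul_sum, mul_add]
    _ ≤ ∑ w ∈ N, (β + β) := by
        refine Finset.sum_le_sum fun w hw => ?_
        have hne : v ≠ w := (Finset.mem_filter.1 hw).2.1.ne
        exact add_le_add ((measure_hit_le hr hne).trans (hβ v))
          ((measure_hit_le hr hne.symm).trans (hβ w))
    _ = N.card * (2 * β) := by rw [Finset.sum_const, nsmul_eq_mul, two_mul]
    _ ≤ A * (2 * β) := by
        gcongr
        exact card_level_eq_le hr' v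
    _ = (2 * A) * β := by ring

theorem measure_conflict_le {K : ℕ} (hK : alive G A K = ∅) (j : ℕ) (v : Fin n) :
    (2 ^ t) ^ j * coinMeasure n (conflict G A t (K + j) v) ≤ (2 * A) ^ j := by
  have : IsProbabilityMeasure (coinMeasure n) := by unfold coinMeasure; infer_instance
  have h0 : (2 ^ t : ℝ≥0∞) ≠ 0 := by positivity
  have h1 : (2 ^ t : ℝ≥0∞) ≠ ⊤ := by finiteness
  induction j generalizing v with
  | zero => simpa using prob_le_one
  | succ j ih =>
    have hr : alive G A (K + j) = ∅ :=
      Finset.subset_empty.1 (hK ▸ alive_antitone (G := G) (A := A) (Nat.le_add_right K j))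
    have hβ : ∀ v, coinMeasure n (conflict G A t (K + j) v) ≤ (2 * A) ^ j / (2 ^ t) ^ j := by
      intro v
      rw [ENNReal.le_div_iff_mul_le (Or.inl (by positivity)) (Or.inl (by finiteness)), mul_comm]
      exact ih v
    calc _ = (2 ^ t) ^ j * (2 ^ t * coinMeasure n (conflict G A t (K + j + 1) v)) := by
          rw [pow_succ, mul_assoc, add_assoc]
      _ ≤ (2 ^ t) ^ j * ((2 * A) * ((2 * A) ^ j / (2 ^ t) ^ j)) := by
          gcongr _ * ?_
          exact measure_conflict_succ_le hr hβ v
      _ = (2 * A) * ((2 ^ t) ^ j * ((2 * A) ^ j / (2 ^ t) ^ j)) := by ring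
      _ = _ := by
          rw [ENNReal.mul_div_cancel (by positivity) (by finiteness), pow_succ']

end

/-! ### The program carries out the process -/

section

variable {n : ℕ} {G : SimpleGraph (Fin n)}

theorem card_ports_eq (port : PortNumbering G) (v : Fin n) (f : Fin n → ℕ) (c : ℕ) (g : ℕ → ℕ)
    [DecidablePred fun w => G.Adj v w ∧ f w = c]
    (hg : ∀ i (hi : i < Nat.card (G.neighborSet v)), g i = f (port v ⟨i, hi⟩)) :
    ((Finset.range (Nat.card (G.neighborSet v))).filter fun i => g i = c).card =
      (Finset.univ.filter fun w => G.Adj v w ∧ f w = c).card := by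
  have hlt : ∀ i ∈ (Finset.range (Nat.card (G.neighborSet v))).filter fun i => g i = c,
      i < Nat.card (G.neighborSet v) := fun i hi => Finset.mem_range.1 (Finset.mem_filter.1 hi).1
  refine Finset.card_bij (fun i hi => (port v ⟨i, hlt i hi⟩ : Fin n)) ?_ ?_ ?_
  · intro i hi
    refine Finset.mem_filter.2 ⟨Finset.mem_univ _, (port v ⟨i, hlt i hi⟩).2, ?_⟩
    rw [← hg, (Finset.mem_filter.1 hi).2]
  · intro i hi j hj hij
    exact Fin.mk.inj ((port v).injective (Subtype.ext hij))
  · intro w hw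
    obtain ⟨-, hvw, hw⟩ := Finset.mem_filter.1 hw
    have e : port v ⟨(port v).symm ⟨w, hvw⟩, Fin.is_lt _⟩ = ⟨w, hvw⟩ :=
      (port v).apply_symm_apply ⟨w, hvw⟩
    refine ⟨(port v).symm ⟨w, hvw⟩, ?_, by rw [e]⟩
    rw [Finset.mem_filter, Finset.mem_range]
    refine ⟨Fin.is_lt _, ?_⟩
    rw [hg _ (Fin.is_lt _), e, ← hw]

theorem runFor_colorProg {K D B A t r : ℕ} (hK : 1 ≤ K) (hD : 1 ≤ D)
    (hB : n * (2 * K + 2 * D + 80) + 100 ≤ B) (hA : A = 2 ^ Nat.clog (2 ^ K) n)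
    (ht : t = Nat.clog (2 ^ D) n + Nat.clog (2 ^ K) n) (port : PortNumbering G) (ω : Coins n)
    (v : Fin n) {s : Local} (h0 : s.mem 0 = n) (h2 : s.mem 2 = Nat.card (G.neighborSet v))
    (h3 : s.mem 3 = color G A t ω r v) (h4 : s.mem 4 = level G A r v)
    (hin : ∀ i (hi : i < Nat.card (G.neighborSet v)), s.inbox i = color G A t ω r (port v ⟨i, hi⟩))
    (hc : s.coins = fun j => ω (v, r, j)) :
    (runFor (colorProg K D) B s).1 = [] ∧ (runFor (colorProg K D) B s).2.mem 0 = n ∧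
      (runFor (colorProg K D) B s).2.mem 2 = Nat.card (G.neighborSet v) ∧
      (runFor (colorProg K D) B s).2.mem 3 = color G A t ω (r + 1) v ∧
      (runFor (colorProg K D) B s).2.mem 4 = level G A (r + 1) v ∧
      ∀ i < Nat.card (G.neighborSet v),
        (runFor (colorProg K D) B s).2.outbox i = color G A t ω (r + 1) v := by
  classical
  have hdeg : Nat.card (G.neighborSet v) ≤ n :=
    (Finite.card_subtype_le _).trans_eq (Nat.card_fin n)
  obtain ⟨q, q0, q2, q4, q3, qo⟩ :=
    runFor_of_ends (ends_colorProg (k := K) (d := D) hK hD h0 h2 hdeg h3 h4) hB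
  have hlev : (if color G A t ω r v = 0 then level G A r v + 1 else level G A r v) =
      level G A (r + 1) v := by
    simp only [color_eq_zero_iff, level]
  have hcol : (runFor (colorProg K D) B s).2.mem 3 = color G A t ω (r + 1) v := by
    rw [q3 _ _ rfl rfl, card_ports_eq port v _ _ _ hin, hlev, ← hA, ← ht, hc, color]
    by_cases hv : v ∈ alive G A r
    · have hv0 : color G A t ω r v = 0 := color_eq_zero_iff.2 hv
      rw [if_pos hv0, if_pos hv, hv0]
      simp only [color_eq_zero_iff]
      simp only [mem_alive_succ, hv, true_and]
      rw [← ite_not]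
      simp only [not_le]
    · have hv0 : color G A t ω r v ≠ 0 := mt color_eq_zero_iff.1 hv
      rw [if_neg hv0, if_neg hv, ← ite_not]
      congr 1
      simp [Finset.filter_eq_empty_iff]
  refine ⟨q, q0, q2, hcol, q4.trans hlev, fun i hi => ?_⟩
  rw [qo i hi, hcol]

theorem config_colorProg {K D B A t : ℕ} (hK : 1 ≤ K) (hD : 1 ≤ D)
    (hB : n * (2 * K + 2 * D + 80) + 100 ≤ B) (hA : A = 2 ^ Nat.clog (2 ^ K) n)
    (ht : t = Nat.clog (2 ^ D) n + Nat.clog (2 ^ K) n) (port : PortNumbering G) (ω : Coins n)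
    (r : ℕ) (v : Fin n) :
    (config (colorProg K D) B port ω r v).1 = [] ∧
      (config (colorProg K D) B port ω r v).2.mem 0 = n ∧
      (config (colorProg K D) B port ω r v).2.mem 2 = Nat.card (G.neighborSet v) ∧
      (config (colorProg K D) B port ω r v).2.mem 3 = color G A t ω (r + 1) v ∧
      (config (colorProg K D) B port ω r v).2.mem 4 = level G A (r + 1) v ∧
      ∀ i < Nat.card (G.neighborSet v),
        (config (colorProg K D) B port ω r v).2.outbox i = color G A t ω (r + 1) v := by
  induction r generalizing v with
  | zero =>
    -- At the start all colours are `0`, in agreement with the empty inbox and the zeroed cells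
    -- `M[3]` and `M[4]`.
    exact runFor_colorProg hK hD hB hA ht port ω v rfl rfl rfl rfl (fun _ _ => rfl) rfl
  | succ r ih =>
    obtain ⟨-, h0, h2, h3, h4, -⟩ := ih v
    refine runFor_colorProg hK hD hB hA ht port ω v h0 h2 h3 h4 (fun i hi => ?_) rfl
    simp only [deliver, dif_pos hi]
    exact (ih _).2.2.2.2.2 _ (Fin.is_lt _)

end

/-! ### Parameters and the final estimates -/

/-- With `s` one less than the logarithm, `(2 ^ s) ^ K < n`; rounding up costs the factor `2`. -/
theorem two_pow_clog_le {K n : ℕ} (hK : 1 ≤ K) (hn : 1 < n) :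
    (2 : ℝ) ^ Nat.clog (2 ^ K) n ≤ 2 * (n : ℝ) ^ (1 / (K : ℝ)) := by
  have hb : 1 < 2 ^ K := Nat.one_lt_pow (by omega) one_lt_two
  obtain ⟨s, hs⟩ := Nat.exists_eq_succ_of_ne_zero (Nat.clog_pos hb hn).ne'
  have h1 := Nat.pow_pred_clog_lt_self hb hn
  rw [hs, Nat.pred_succ] at h1
  rw [hs, pow_succ', mul_le_mul_iff_right₀ two_pos,
    ← pow_le_pow_iff_left₀ (by positivity) (by positivity) (by omega : K ≠ 0),
    ← Real.rpow_mul_natCast n.cast_nonneg, one_div_mul_cancel (by positivity), Real.rpow_one,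
    ← pow_mul, mul_comm s, pow_mul]
  exact_mod_cast h1.le

/-- The bound `hn` absorbs the factor `2 ^ (D (c + 2))` of the failure probability into one factor
`n`; `hn'` absorbs the number of levels and the two roundings into one factor `n ^ (1 / D)` of the
palette. -/
theorem isProperColoring_colorProg {c D K n : ℕ} (hK : 1 ≤ K) (hKD : K ≤ D)
    (hn : 2 ^ (D * (c + 2)) ≤ n) (hn' : (4 * (D * (c + 3) + 2)) ^ D ≤ n)
    {G : SimpleGraph (Fin n)} (hG : ((2 * K : ℕ) : ℕ∞) < G.egirth) (port : PortNumbering G)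
    {B T : ℕ} (hB : n * (2 * K + 2 * D + 80) + 100 ≤ B) (hT : T = K - 1 + D * (c + 2)) :
    LocalTimeAtMost (colorProg K D) T B port ∧
    MessagesAtMost (colorProg K D) T B (6 * Nat.log 2 n) port ∧
    coinMeasure n {ω | ¬ IsProperColoring G ((n : ℝ) ^ (1 / (K : ℝ) + 2 / D))
      (output (colorProg K D) T B port ω)} ≤ ((n : ℝ≥0∞) ^ c)⁻¹ := by
  have hD : 1 ≤ D := hK.trans hKD
  obtain ⟨A, hA⟩ : ∃ A, A = 2 ^ Nat.clog (2 ^ K) n := ⟨_, rfl⟩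
  obtain ⟨t, ht⟩ : ∃ t, t = Nat.clog (2 ^ D) n + Nat.clog (2 ^ K) n := ⟨_, rfl⟩
  have hconf := config_colorProg hK hD hB hA ht port
  have hn2 : 1 < n := lt_of_lt_of_le (Nat.one_lt_pow (by positivity) one_lt_two) hn
  have hn0 : (0 : ℝ) < n := by exact_mod_cast (by omega)
  have hn1 : (1 : ℝ) ≤ n := by exact_mod_cast hn2.le
  have hempty : alive G A K = ∅ := by
    refine alive_eq_empty hK ?_ hG
    rw [Fintype.card_fin, hA, ← pow_mul, mul_comm, pow_mul]
    exact Nat.le_pow_clog (Nat.one_lt_pow (by omega) one_lt_two) n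
  have hTD : T ≤ D * (c + 3) := by
    rw [hT, show D * (c + 3) = D + D * (c + 2) by ring]
    omega
  have hcolor : ∀ ω r v, r ≤ T →
      (color G A t ω (r + 1) v : ℝ) ≤ (n : ℝ) ^ (1 / (K : ℝ) + 2 / D) := by
    intro ω r v hr
    have h1 : (color G A t ω (r + 1) v : ℝ) ≤ ((D * (c + 3) + 2 : ℕ) : ℝ) * 2 ^ t := by
      have := (color_lt (G := G) (A := A) (t := t) ω (r + 1) v).le.trans
        (Nat.mul_le_mul_right (2 ^ t) (by omega : r + 1 + 1 ≤ D * (c + 3) + 2))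
      exact_mod_cast this
    have h2 : (2 : ℝ) ^ t ≤ (2 * (n : ℝ) ^ (1 / (D : ℝ))) * (2 * (n : ℝ) ^ (1 / (K : ℝ))) := by
      rw [ht, pow_add]
      exact mul_le_mul (two_pow_clog_le hD hn2) (two_pow_clog_le hK hn2) (by positivity)
        (by positivity)
    have h3 : ((4 * (D * (c + 3) + 2) : ℕ) : ℝ) ≤ (n : ℝ) ^ (1 / (D : ℝ)) := by
      rw [← pow_le_pow_iff_left₀ (by positivity) (by positivity) (by omega : D ≠ 0),
        ← Real.rpow_mul_natCast n.cast_nonneg, one_div_mul_cancel (by positivity), Real.rpow_one]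
      exact_mod_cast hn'
    calc (color G A t ω (r + 1) v : ℝ)
        ≤ ((D * (c + 3) + 2 : ℕ) : ℝ) *
            ((2 * (n : ℝ) ^ (1 / (D : ℝ))) * (2 * (n : ℝ) ^ (1 / (K : ℝ)))) :=
          h1.trans (by gcongr)
      _ = ((4 * (D * (c + 3) + 2) : ℕ) : ℝ) *
            ((n : ℝ) ^ (1 / (D : ℝ)) * (n : ℝ) ^ (1 / (K : ℝ))) := by push_cast; ring
      _ ≤ (n : ℝ) ^ (1 / (D : ℝ)) * ((n : ℝ) ^ (1 / (D : ℝ)) * (n : ℝ) ^ (1 / (K : ℝ))) := by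
          gcongr
      _ = _ := by
          rw [← Real.rpow_add hn0, ← Real.rpow_add hn0]
          congr 1
          ring
  refine ⟨fun ω r _ v => (hconf ω r v).1, fun ω r hr v i hi => ?_, ?_⟩
  · rw [(hconf ω r v).2.2.2.2.2 i hi, Nat.size_le]
    have h1 : (color G A t ω (r + 1) v : ℝ) ≤ (n : ℝ) ^ (3 : ℝ) := by
      refine (hcolor ω r v hr.le).trans (Real.rpow_le_rpow_of_exponent_le hn1 ?_)
      have hK' : (1 : ℝ) ≤ K := by exact_mod_cast hK
      have hD' : (1 : ℝ) ≤ D := by exact_mod_cast hD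
      have e1 : 1 / (K : ℝ) ≤ 1 := (div_le_one (by positivity)).2 hK'
      have e2 : 2 / (D : ℝ) ≤ 2 := div_le_self two_pos.le hD'
      linarith
    have h2 : color G A t ω (r + 1) v ≤ n ^ 3 := by
      rw [show (3 : ℝ) = (3 : ℕ) by norm_num, Real.rpow_natCast] at h1
      exact_mod_cast h1
    have h3 : n < 2 ^ (Nat.log 2 n + 1) := Nat.lt_pow_succ_log_self one_lt_two n
    have h4 : 1 ≤ Nat.log 2 n := Nat.log_pos one_lt_two hn2
    calc color G A t ω (r + 1) v ≤ n ^ 3 := h2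
      _ < (2 ^ (Nat.log 2 n + 1)) ^ 3 := Nat.pow_lt_pow_left h3 (by norm_num)
      _ = 2 ^ ((Nat.log 2 n + 1) * 3) := (pow_mul _ _ _).symm
      _ ≤ 2 ^ (6 * Nat.log 2 n) := Nat.pow_le_pow_right two_pos (by omega)
  · have hTK : T + 1 = K + D * (c + 2) := by omega
    have hout : ∀ ω v, output (colorProg K D) T B port ω v = color G A t ω (T + 1) v :=
      fun ω v => (hconf ω T v).2.2.2.1
    have halive : alive G A (T + 1) = ∅ :=
      Finset.subset_empty.1 (hempty ▸ alive_antitone (by omega))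
    have hsub : {ω | ¬ IsProperColoring G ((n : ℝ) ^ (1 / (K : ℝ) + 2 / D))
        (output (colorProg K D) T B port ω)} ⊆ ⋃ v ∈ Finset.univ, conflict G A t (T + 1) v := by
      intro ω hω
      by_contra hno
      simp only [Finset.mem_univ, Set.iUnion_true, Set.mem_iUnion, not_exists] at hno
      refine hω ⟨fun v => ?_, fun u v huv h => hno u ⟨v, huv, ?_⟩⟩
      · rw [hout]
        refine ⟨Nat.one_le_iff_ne_zero.2 fun h => ?_, hcolor ω T v le_rfl⟩
        rw [color_eq_zero_iff, halive] at h
        simp at h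
      · rw [hout, hout] at h
        exact h.symm
    set j := D * (c + 2) with hj
    have hone : ∀ v, ((n : ℝ≥0∞) ^ (c + 1)) * coinMeasure n (conflict G A t (T + 1) v) ≤ 1 := by
      intro v
      have h1 := measure_conflict_le (t := t) hempty j v
      rw [← hTK] at h1
      have hs : ((2 : ℝ≥0∞) * A) ^ j = (A : ℝ≥0∞) ^ j * 2 ^ j := by rw [mul_pow, mul_comm]
      have ht' : ((2 : ℝ≥0∞) ^ t) ^ j = (A : ℝ≥0∞) ^ j * (2 ^ Nat.clog (2 ^ D) n) ^ j := by
        rw [ht, hA, pow_add, mul_pow, mul_comm]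
        push_cast
        rfl
      have hA0 : (A : ℝ≥0∞) ^ j ≠ 0 := by simp [hA]
      rw [hs, ht', mul_assoc, ENNReal.mul_le_mul_iff_right hA0 (by finiteness)] at h1
      have h2 : (n : ℝ≥0∞) ^ (c + 2) ≤ (2 ^ Nat.clog (2 ^ D) n) ^ j := by
        rw [hj, pow_mul, ← pow_mul 2, mul_comm _ D, pow_mul 2]
        gcongr
        exact_mod_cast Nat.le_pow_clog (Nat.one_lt_pow (by omega) one_lt_two) n
      have h3 : (2 : ℝ≥0∞) ^ j ≤ n := by exact_mod_cast hn
      -- The common factor `A ^ j` has been cancelled; one of the `c + 2` factors `n` pays for `2 ^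
      -- j`.
      have h4 : (n : ℝ≥0∞) * ((n : ℝ≥0∞) ^ (c + 1) * coinMeasure n (conflict G A t (T + 1) v)) ≤
          n * 1 := by
        rw [← mul_assoc, ← pow_succ', mul_one]
        exact (mul_le_mul_left h2 _).trans (h1.trans h3)
      rwa [ENNReal.mul_le_mul_iff_right (by simp; omega) (by finiteness)] at h4
    refine (measure_mono hsub).trans ((measure_biUnion_finset_le _ _).trans ?_)
    have hnn : (n : ℝ≥0∞) ≠ 0 := by simp; omega
    have hle : ∀ v ∈ Finset.univ, coinMeasure n (conflict G A t (T + 1) v) ≤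
        ((n : ℝ≥0∞) ^ (c + 1))⁻¹ := fun v _ => by
      rw [ENNReal.le_inv_iff_mul_le, mul_comm]
      exact hone v
    refine (Finset.sum_le_sum hle).trans_eq ?_
    rw [Finset.sum_const, Finset.card_univ, Fintype.card_fin, nsmul_eq_mul, pow_succ',
      ENNReal.mul_inv (Or.inl hnn) (Or.inl (by finiteness)), ← mul_assoc,
      ENNReal.mul_inv_cancel hnn (by finiteness), one_mul]

/-- If there are at least `n` colours, every vertex may output its identity number. -/
theorem isProperColoring_identity {n : ℕ} {q : ℝ} (hq : (n : ℝ) ≤ q)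
    {G : SimpleGraph (Fin n)} (port : PortNumbering G) (c L : ℕ) :
    LocalTimeAtMost (.add 3 1 15) 0 1 port ∧ MessagesAtMost (.add 3 1 15) 0 1 L port ∧
    coinMeasure n {ω | ¬ IsProperColoring G q (output (.add 3 1 15) 0 1 port ω)} ≤
      ((n : ℝ≥0∞) ^ c)⁻¹ := by
  refine ⟨fun ω r hr v => ?_, fun ω r hr => absurd hr r.not_lt_zero, ?_⟩
  · obtain rfl := Nat.le_zero.1 hr
    rfl
  · have hout : ∀ ω v, output (.add 3 1 15) 0 1 port ω v = (v : ℕ) + 1 := fun ω v => rfl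
    have : {ω | ¬ IsProperColoring G q (output (.add 3 1 15) 0 1 port ω)} = ∅ := by
      refine Set.eq_empty_iff_forall_notMem.2 fun ω hω => hω ⟨fun v => ?_, fun u v huv h => ?_⟩
      · rw [hout]
        exact ⟨by omega, le_trans (by exact_mod_cast v.2) hq⟩
      · rw [hout, hout] at h
        exact huv.ne (Fin.ext (by omega))
    rw [this, measure_empty]
    exact zero_le

end Distributed

theorem mainTheorem6 :
    ∀ c : ℕ, ∃ C : ℕ, ∀ ε : ℝ, 0 < ε → ∃ (n₀ : ℕ) (p : Polynomial ℕ), ∀ k : ℕ, 2 ≤ k →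
      ∃ (P : Distributed.Prog) (T : ℕ), (T : ℝ) ≤ C / ε ^ 2 ∧
        ∀ n : ℕ, n₀ ≤ n → ∀ G : SimpleGraph (Fin n), ((2 * k : ℕ) : ℕ∞) < G.egirth →
          ∀ port : Distributed.PortNumbering G,
            Distributed.LocalTimeAtMost P T (p.eval n) port ∧
            Distributed.MessagesAtMost P T (p.eval n) (C * Nat.log 2 n) port ∧
            Distributed.coinMeasure n
              {ω | ¬ Distributed.IsProperColoring G ((n : ℝ) ^ (1 / (k : ℝ) + ε))
                (Distributed.output P T (p.eval n) port ω)} ≤ ((n : ℝ≥0∞) ^ c)⁻¹ := by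
  intro c
  refine ⟨4 * (c + 3), fun ε hε => ?_⟩
  rcases le_or_gt 1 ε with h1 | h1
  -- For `ε ≥ 1` the palette has at least `n` colours, and the identity numbers serve without
  -- communication.
  · refine ⟨1, 1, fun k _ => ⟨.add 3 1 15, 0, by simp; positivity, fun n hn G _ port => ?_⟩⟩
    rw [Polynomial.eval_one]
    refine Distributed.isProperColoring_identity ?_ port c _
    have hn' : (1 : ℝ) ≤ n := by exact_mod_cast hn
    have hk : 0 ≤ 1 / (k : ℝ) := by positivity
    exact (Real.rpow_one _).symm.le.trans (Real.rpow_le_rpow_of_exponent_le hn' (by linarith))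
  · obtain ⟨D, hD⟩ : ∃ D, D = ⌈3 / ε⌉₊ := ⟨_, rfl⟩
    have hD3 : 3 / ε ≤ D := hD ▸ Nat.le_ceil _
    have hD4 : (D : ℝ) ≤ 4 / ε := by
      have e1 : (D : ℝ) < 3 / ε + 1 := hD ▸ Nat.ceil_lt_add_one (by positivity)
      have e2 : 1 ≤ 1 / ε := (one_le_div hε).2 h1.le
      have e3 : 4 / ε = 3 / ε + 1 / ε := by ring
      linarith
    have hDpos : (0 : ℝ) < D := lt_of_lt_of_le (by positivity) hD3
    have hD1 : 1 ≤ D := by exact_mod_cast hDpos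
    have hDε : 3 / (D : ℝ) ≤ ε := by
      rw [div_le_iff₀ hDpos, mul_comm]
      exact (div_le_iff₀ hε).1 hD3
    -- Replacing `k` by `min k D` bounds rounds and local time independently of `k`, at the cost of
    -- at most `1 / D` in the exponent. The girth hypothesis only weakens.
    refine ⟨max (2 ^ (D * (c + 2))) ((4 * (D * (c + 3) + 2)) ^ D),
      Polynomial.C (4 * D + 80) * Polynomial.X + Polynomial.C 100, fun k hk => ?_⟩
    have hKD : min k D ≤ D := min_le_right _ _
    have hK1 : 1 ≤ min k D := le_min (by omega) hD1
    refine ⟨Distributed.colorProg (min k D) D, min k D - 1 + D * (c + 2), ?_,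
      fun n hn G hG port => ?_⟩
    · calc ((min k D - 1 + D * (c + 2) : ℕ) : ℝ) ≤ ((D * (c + 3) : ℕ) : ℝ) := by
            rw [show D * (c + 3) = D + D * (c + 2) by ring]
            exact_mod_cast (by omega)
        _ = (D : ℝ) * (c + 3) := by push_cast; ring
        _ ≤ 4 / ε * (c + 3) := by gcongr
        _ = 4 * (c + 3) / ε := by ring
        -- The number of rounds is even linear in `1 / ε`; here `ε < 1`.
        _ ≤ 4 * (c + 3) / ε ^ 2 := by
            gcongr
            nlinarith
        _ = _ := by push_cast; ring
    · have hp : (Polynomial.C (4 * D + 80) * Polynomial.X + Polynomial.C 100).eval n =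
          (4 * D + 80) * n + 100 := by simp
      rw [hp]
      have hg : ((2 * min k D : ℕ) : ℕ∞) < G.egirth :=
        lt_of_le_of_lt (by exact_mod_cast Nat.mul_le_mul_left 2 (min_le_left k D)) hG
      obtain ⟨r1, r2, r3⟩ := Distributed.isProperColoring_colorProg (c := c) hK1 hKD
        (le_of_max_le_left hn) (le_of_max_le_right hn) hg port
        (B := (4 * D + 80) * n + 100) (by nlinarith) rfl
      refine ⟨r1, fun ω r hr v i hi => (r2 ω r hr v i hi).trans ?_,
        (MeasureTheory.measure_mono ?_).trans r3⟩
      · exact Nat.mul_le_mul_right _ (by omega)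
      · intro ω hω hcol
        refine hω ⟨fun v => ⟨(hcol.1 v).1, (hcol.1 v).2.trans ?_⟩, hcol.2⟩
        have hn1 : (1 : ℝ) ≤ n := by
          exact_mod_cast (Nat.one_le_two_pow).trans (le_of_max_le_left hn)
        refine Real.rpow_le_rpow_of_exponent_le hn1 ?_
        have hk0 : (0 : ℝ) < k := by exact_mod_cast (by omega)
        have hmin : 1 / ((min k D : ℕ) : ℝ) ≤ 1 / k + 1 / D := by
          rcases min_choice k D with h | h <;> rw [h]
          · linarith [one_div_pos.2 hDpos]
          · linarith [one_div_pos.2 hk0]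
        have e3 : 3 / (D : ℝ) = 1 / D + 2 / D := by ring
        linarith
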